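/- Let $\Gamma$ be a finite simple connected $3$-valent plane graph all of whose faces (the unbounded face included) are $4$-gons or $6$-gons. Suppose that $\Gamma$ is isometrically embeddable in a hypercube, i.e. for some $m$ there is a map $\phi$ from the vertices of $\Gamma$ to $H_m=\{0,1\}^m$ such that for all vertices $x,y$ the path distance $d_\Gamma(x,y)$ equals the number of coordinates in which $\phi(x)$ and $\phi(y)$ differ. Then $\Gamma$ is isomorphic to one of the following five graphs: 1. the Cube (the graph of the $3$-dimensional cube, $8$ vertices); 2. the $6$-gonal prism ($12$ vertices); 3. the truncated Octahedron ($24$ vertices); 4. the chamfered Cube ($32$ vertices): its vertices are the vertices $v$ of the cube and the pairs $(v,F)$ of a face $F$ of the cube and a vertex $v$ of $F$; each $v$ is adjacent to the three pairs $(v,F)$, and $(v,F)$ is adjacent to $(w,F)$ whenever $vw$ is an edge of $F$; 5. the twisted chamfered Cube ($32$ vertices): the graph obtained from the chamfered Cube by cutting it into two halves along the plane through the centre orthogonal to a $3$-fold axis (this plane cuts six edges, which separate a belt of six hexagons), turning one half by $60^\circ$ about this axis and joining the six pairs of cut edge ends that now face each other. -/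

import Mathlib

/-- A rotation system on a graph: around every vertex, the darts leaving that vertex are arranged
in one cyclic order, `next d` being the dart that follows `d`. It encodes a cellular embedding
of a connected graph in a closed oriented surface. -/
structure RotationSystem {V : Type*} (G : SimpleGraph V) where
  next : Equiv.Perm G.Dart
  next_fst : ∀ d : G.Dart, (next d).fst = d.fst
  sameCycle : ∀ d e : G.Dart, d.fst = e.fst → next.SameCycle d e

namespace RotationSystem

variable {V : Type*} {G : SimpleGraph V}

/-- Reversal of darts as a permutation. -/
def dartRev (G : SimpleGraph V) : Equiv.Perm G.Dart where
  toFun d := d.symm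
  invFun d := d.symm
  left_inv d := d.symm_symm
  right_inv d := d.symm_symm

/-- The face permutation: walk along the dart `d` to its head and leave the head along the dart
that follows the reversed dart in the rotation. Its cycles are the boundary walks of the faces. -/
def facePerm (R : RotationSystem G) : Equiv.Perm G.Dart :=
  (dartRev G).trans R.next

/-- The faces, i.e. the cycles of the face permutation. -/
def Face (R : RotationSystem G) : Type _ :=
  Quotient (Equiv.Perm.SameCycle.setoid R.facePerm)

/-- The face to the side of the dart `d` is a `k`-gon: its boundary walk has length `k`. -/
def FaceIsGon (R : RotationSystem G) (d : G.Dart) (k : ℕ) : Prop :=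
  Function.minimalPeriod R.facePerm d = k

/-- For a finite connected graph: the surface is the sphere, i.e. `|V| - |E| + |F| = 2`. -/
def IsSpherical (R : RotationSystem G) : Prop :=
  (Nat.card V : ℤ) - Nat.card G.edgeSet + Nat.card R.Face = 2

end RotationSystem

/-- `G`, with the plane embedding given by `R`, is a graph `4_n`: a finite connected `3`-valent
plane graph all of whose faces (the unbounded one included) are `4`-gons or `6`-gons. -/
structure IsGraphFourN {V : Type*} [Fintype V] (G : SimpleGraph V) [DecidableRel G.Adj]
    (R : RotationSystem G) : Prop where
  connected : G.Connected
  trivalent : G.IsRegularOfDegree 3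
  plane : R.IsSpherical
  faces : ∀ d : G.Dart, R.FaceIsGon d 4 ∨ R.FaceIsGon d 6

/-- `G` embeds isometrically in a hypercube `H_m = {0,1}^m`; the distance of `H_m` is the number
of coordinates in which two points differ. -/
def IsometricInHypercube {V : Type*} (G : SimpleGraph V) : Prop :=
  ∃ (m : ℕ) (φ : V → (Fin m → Bool)), ∀ x y : V, hammingDist (φ x) (φ y) = G.dist x y

/-- The graph of the cube. -/
def cubeGraph : SimpleGraph (Fin 3 → Bool) where
  Adj x y := hammingDist x y = 1
  symm := ⟨fun x y h => by rw [hammingDist_comm]; exact h⟩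
  loopless := ⟨fun x h => by simp at h⟩

/-- The graph of the `6`-gonal prism. -/
def hexagonalPrism : SimpleGraph (Fin 6 × Fin 2) :=
  (SimpleGraph.cycleGraph 6).boxProd (⊤ : SimpleGraph (Fin 2))

/-- The graph of the octahedron: `(i, b)` is one of the two vertices on the `i`-th axis, and two
vertices are adjacent unless they are equal or opposite. -/
def octahedron : SimpleGraph (Fin 3 × Bool) where
  Adj p q := p.1 ≠ q.1
  symm := ⟨fun _ _ h => h.symm⟩
  loopless := ⟨fun _ h => h rfl⟩

/-- The graph of the truncated octahedron. Cutting off the vertices of the octahedron leaves two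
vertices on each edge `vw`: one near `v`, the dart `v → w`, and one near `w`, the dart `w → v`.
These two are adjacent, and near `v` the darts `v → w` and `v → w'` are adjacent if `vww'` is a
face; all triangles of the octahedron are faces. -/
def truncatedOctahedron : SimpleGraph octahedron.Dart where
  Adj d e := e = d.symm ∨ (d.fst = e.fst ∧ octahedron.Adj d.snd e.snd)
  symm := ⟨by
    rintro d e (h | ⟨h, h'⟩)
    · exact Or.inl (by rw [h, SimpleGraph.Dart.symm_symm])
    · exact Or.inr ⟨h.symm, h'.symm⟩⟩
  loopless := ⟨by
    rintro d (h | ⟨_, h⟩)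
    · exact d.symm_ne h.symm
    · exact h.ne rfl⟩

/-- The vertices of the chamfered cube: `(v, none)` is the vertex `v` of the cube, and
`(v, some i)` is the corner belonging to `v` of the shrunken copy of the face of the cube that
contains `v` and is orthogonal to the `i`-th axis. -/
abbrev ChamferVertex : Type := (Fin 3 → Bool) × Option (Fin 3)

/-- The graph of the chamfered cube: every vertex of the cube is joined to the corresponding
corners of the three shrunken faces around it, and the edges of the shrunken faces are kept, while
the edges of the cube itself are replaced by hexagons. -/
def chamferedCube : SimpleGraph ChamferVertex :=
  SimpleGraph.fromRel fun p q =>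
    (p.2 = none ∧ q.2 ≠ none ∧ p.1 = q.1) ∨
    (∃ i : Fin 3, p.2 = some i ∧ q.2 = some i ∧ p.1 i = q.1 i ∧ cubeGraph.Adj p.1 q.1)

/-- For `b = false` the vertex of the cube whose only coordinate `1` is the `i`-th, and for
`b = true` the opposite vertex. -/
def beltVertex (i : Fin 3) (b : Bool) : Fin 3 → Bool :=
  fun j => xor (decide (j = i)) b

/-- The six edges of the chamfered cube that cross the plane through its centre orthogonal to the
`3`-fold axis through `000` and `111`. They separate six hexagons that form a belt around this
axis. -/
def beltEdges : Set (Sym2 ChamferVertex) :=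
  {e | ∃ (i : Fin 3) (b : Bool), e = s((beltVertex i b, none), (beltVertex i b, some i))}

/-- The edges that replace the belt edges once one of the two halves has been turned about the
`3`-fold axis by an odd multiple of `60` degrees: now the ends in the two halves that were opposite
to each other with respect to the centre are joined. -/
def twistedBeltEdges : Set (Sym2 ChamferVertex) :=
  {e | ∃ (i : Fin 3) (o : Option (Fin 3)), (o = none ∨ o = some i) ∧
    e = s((beltVertex i false, o), (beltVertex i true, o))}

/-- The graph of the twisted chamfered cube: cut the chamfered cube in two halves by the plane
through the centre orthogonal to a `3`-fold axis, turn one half by `60` degrees about this axis,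
and glue the halves again. -/
def twistedChamferedCube : SimpleGraph ChamferVertex :=
  chamferedCube.deleteEdges beltEdges ⊔ SimpleGraph.fromEdgeSet twistedBeltEdges

/-- A corner of a face: at the vertex with code `code` the edge labelled `right` follows the edge
labelled `left` in the rotation. -/
structure PatchCorner where
  code : ℕ
  left : ℕ
  right : ℕ

/-- A vertex together with the labels of its three edges in rotation order. -/
structure PatchStar where
  code : ℕ
  fst : ℕ
  snd : ℕ
  trd : ℕ

/-- Partial information on a plane cubic graph in a hypercube: the vertices of which a single
corner is known, the vertices that are completely known, and the corners whose faces are still to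
be explored. All labels are less than `labels`. -/
structure Patch where
  labels : ℕ
  corners : List PatchCorner
  stars : List PatchStar
  agenda : List PatchCorner

namespace PatchStar

/-- Whether `q` follows `p` in the rotation. -/
def follows (s : PatchStar) (p q : ℕ) : Bool :=
  (Nat.beq s.fst p && Nat.beq s.snd q) || (Nat.beq s.snd p && Nat.beq s.trd q) ||
    (Nat.beq s.trd p && Nat.beq s.fst q)

/-- The set of labels at a vertex, as a bit mask. -/
def mask (s : PatchStar) : ℕ := 2 ^ s.fst ||| 2 ^ s.snd ||| 2 ^ s.trd

/-- A vertex with code `y` can be reached by a geodesic that starts with an edge of the star. -/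
def sees (s : PatchStar) (y : ℕ) : Bool :=
  Nat.beq s.code y || !Nat.beq ((s.code ^^^ y) &&& s.mask) 0

end PatchStar

namespace Patch

def findStar (x : ℕ) : List PatchStar → Option PatchStar
  | [] => none
  | s :: l => bif Nat.beq s.code x then some s else findStar x l

def findCorner (x : ℕ) : List PatchCorner → Option PatchCorner
  | [] => none
  | c :: l => bif Nat.beq c.code x then some c else findCorner x l

def dropCode (x : ℕ) : List PatchCorner → List PatchCorner
  | [] => []
  | c :: l => bif Nat.beq c.code x then l else c :: dropCode x l

/-- Every known vertex can be reached by a geodesic that starts with an edge of the star. -/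
def seenBy (S : Patch) (s : PatchStar) : Bool :=
  (S.stars.all fun t => s.sees t.code) && S.corners.all fun c => s.sees c.code

/-- Replace the corner at a vertex by a star, and put the corner `⟨s.code, p, q⟩` on the agenda. -/
def addStar (S : Patch) (s : PatchStar) (p q : ℕ) : Option Patch :=
  bif S.seenBy s then
    some ⟨S.labels, dropCode s.code S.corners, s :: S.stars, ⟨s.code, p, q⟩ :: S.agenda⟩
  else none

/-- Add a corner to a patch; `none` if it contradicts what is known. -/
def insert (S : Patch) (x p q : ℕ) : Option Patch :=
  match findStar x S.stars with
  | some s => bif s.follows p q then some S else none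
  | none =>
    match findCorner x S.corners with
    | none =>
      bif S.stars.all fun s => s.sees x then
        some ⟨S.labels, ⟨x, p, q⟩ :: S.corners, S.stars, S.agenda⟩
      else none
    | some c =>
      bif Nat.beq c.left p && Nat.beq c.right q then some S
      else bif Nat.beq c.right p && !Nat.beq c.left q then S.addStar ⟨x, c.left, p, q⟩ q c.left
      else bif Nat.beq c.left q && !Nat.beq c.right p then S.addStar ⟨x, p, q, c.right⟩ c.right p
      else none

/-- Add the corners along a walk that enters the vertex with code `x` along the label `p` and
then follows the given labels. -/
def insertWalk : Patch → ℕ → ℕ → List ℕ → Option Patch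
  | S, _, _, [] => some S
  | S, x, p, q :: l =>
    match S.insert x p q with
    | none => none
    | some T => insertWalk T (x ^^^ 2 ^ q) q l

/-- Some vertex is known, and all known vertices and their neighbours are completely known. -/
def closed (S : Patch) : Bool :=
  S.corners.isEmpty && !S.stars.isEmpty && S.stars.all fun s =>
    (findStar (s.code ^^^ 2 ^ s.fst) S.stars).isSome &&
    (findStar (s.code ^^^ 2 ^ s.snd) S.stars).isSome &&
    (findStar (s.code ^^^ 2 ^ s.trd) S.stars).isSome

/-- The continuations of the boundary walk of a hexagon that begins with the labels `p`, `q` and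
has `c` as third label. -/
def hexWalks (p q c : ℕ) : List (List ℕ) :=
  [[q, c, p, q, c, p], [q, p, c, q, c, p], [q, c, p, c, q, p], [q, c, q, p, c, p]]

def memCode (x : ℕ) : List ℕ → Bool
  | [] => false
  | y :: l => Nat.beq x y || memCode x l

/-- The codes of the completely known vertices are those in the list `K`. -/
def hasCodes (S : Patch) (K : List ℕ) : Bool :=
  (S.stars.all fun s => memCode s.code K) && K.all fun x => (findStar x S.stars).isSome

/-- Explore the faces at the corners of the agenda in all possible ways, up to the given depth;
the answer is `true` if this always leads to a contradiction or to a list of codes in `table`. -/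
def explore (table : List (List ℕ)) : ℕ → Patch → Bool
  | 0, _ => false
  | n + 1, S =>
    bif S.closed then table.any S.hasCodes else
    match S.agenda with
    | [] => false
    | c :: A =>
      (match insertWalk ⟨S.labels, S.corners, S.stars, A⟩ c.code c.left
          [c.right, c.left, c.right, c.left] with
        | none => true
        | some T => explore table n T) &&
      (List.range (S.labels + 1)).all fun e =>
        Nat.beq e c.left || Nat.beq e c.right ||
        (hexWalks c.left c.right e).all fun w =>
          match insertWalk ⟨bif Nat.beq e S.labels then S.labels + 1 else S.labels,
              S.corners, S.stars, A⟩ c.code c.left w with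
          | none => true
          | some T => explore table n T

end Patch

namespace Equiv.Perm

theorem card_sameCycle_eq_minimalPeriod {α : Type*} [Fintype α] [DecidableEq α] (f : Perm α)
    (a : α) [DecidablePred (f.SameCycle a)] :
    (Finset.univ.filter (f.SameCycle a)).card = Function.minimalPeriod f a := by
  have hs : f.IsCycleOn ↑(Finset.univ.filter (f.SameCycle a)) := by
    refine ⟨⟨fun b hb => ?_, f.injective.injOn, fun b hb => ⟨f.symm b, ?_, by simp⟩⟩,
      fun b hb c hc => ?_⟩
    · simpa using hb
    · simpa [Equiv.Perm.sameCycle_symm_apply_right] using hb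
    · simp only [Finset.coe_filter, Finset.mem_univ, true_and, Set.mem_ofPred_eq] at hb hc
      exact hb.symm.trans hc
  have ha : a ∈ Finset.univ.filter (f.SameCycle a) := by simp [SameCycle.refl]
  have hiff : ∀ n, Function.IsPeriodicPt f n a ↔
      (Finset.univ.filter (f.SameCycle a)).card ∣ n := fun n => by
    rw [← hs.pow_apply_eq ha, Function.IsPeriodicPt, Function.IsFixedPt, Equiv.Perm.iterate_eq_pow]
  exact Nat.dvd_antisymm ((hiff _).1 (Function.isPeriodicPt_minimalPeriod _ _))
    ((hiff _).2 dvd_rfl).minimalPeriod_dvd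

end Equiv.Perm

namespace RotationSystem

variable {V : Type*} {G : SimpleGraph V}

theorem facePerm_fst (R : RotationSystem G) (d : G.Dart) : (R.facePerm d).fst = d.snd :=
  R.next_fst d.symm

theorem next_isCycleOn (R : RotationSystem G) (v : V) :
    R.next.IsCycleOn {d : G.Dart | d.fst = v} := by
  refine ⟨⟨fun d hd => ?_, R.next.injective.injOn, fun d hd => ?_⟩, fun d hd e he => ?_⟩
  · exact (R.next_fst d).trans hd
  · refine ⟨R.next.symm d, ?_, R.next.apply_symm_apply d⟩
    have h := R.next_fst (R.next.symm d)
    rw [R.next.apply_symm_apply] at h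
    exact h.symm.trans hd
  · exact R.sameCycle d e (hd.trans he.symm)

variable [Fintype V] [DecidableRel G.Adj] (R : RotationSystem G)

theorem card_darts_fst [DecidableEq V] (hG : G.IsRegularOfDegree 3) (v : V) :
    (Finset.univ.filter fun d : G.Dart => d.fst = v).card = 3 := by
  have h := G.dart_fst_fiber_card_eq_degree v
  rw [hG v] at h
  exact h

theorem next_isCycleOn_filter [DecidableEq V] (v : V) :
    R.next.IsCycleOn ↑(Finset.univ.filter fun d : G.Dart => d.fst = v) := by
  simpa using R.next_isCycleOn v

theorem pow_next_eq_self_iff (hG : G.IsRegularOfDegree 3) (d : G.Dart) (n : ℕ) :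
    (R.next ^ n) d = d ↔ 3 ∣ n := by
  classical
  have h := (R.next_isCycleOn_filter d.fst).pow_apply_eq (a := d) (by simp) (n := n)
  rwa [card_darts_fst hG] at h

theorem next_next_next (hG : G.IsRegularOfDegree 3) (d : G.Dart) :
    R.next (R.next (R.next d)) = d :=
  (R.pow_next_eq_self_iff hG d 3).2 dvd_rfl

theorem next_ne (hG : G.IsRegularOfDegree 3) (d : G.Dart) : R.next d ≠ d := fun h => by
  have := (R.pow_next_eq_self_iff hG d 1).1 h
  omega

theorem next_next_ne (hG : G.IsRegularOfDegree 3) (d : G.Dart) : R.next (R.next d) ≠ d :=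
  fun h => by
  have := (R.pow_next_eq_self_iff hG d 2).1 h
  omega

theorem eq_or_next_or_next (hG : G.IsRegularOfDegree 3) {d e : G.Dart} (h : e.fst = d.fst) :
    e = d ∨ e = R.next d ∨ e = R.next (R.next d) := by
  classical
  obtain ⟨n, hn, rfl⟩ := (R.next_isCycleOn_filter d.fst).exists_pow_eq (a := d) (b := e)
    (by simp) (by simpa using h)
  rw [card_darts_fst hG] at hn
  interval_cases n
  · exact Or.inl rfl
  · exact Or.inr (Or.inl rfl)
  · exact Or.inr (Or.inr rfl)

/-- If all faces were hexagons, the Euler characteristic would vanish. -/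
theorem exists_square (hG : IsGraphFourN G R) : ∃ d, R.FaceIsGon d 4 := by
  classical
  by_contra! hno
  have h6 : ∀ d, Function.minimalPeriod R.facePerm d = 6 := fun d =>
    (hG.faces d).resolve_left (hno d)
  have hE : Fintype.card G.Dart = 2 * G.edgeFinset.card := G.dart_card_eq_twice_card_edges
  have hV : Fintype.card G.Dart = 3 * Fintype.card V := by
    rw [G.dart_card_eq_sum_degrees]
    simp [hG.trivalent.degree_eq, mul_comm]
  have hF : Fintype.card G.Dart = Nat.card R.Face * 6 := by
    let _ : DecidableRel (Equiv.Perm.SameCycle.setoid R.facePerm).r := Classical.decRel _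
    let _ : Fintype R.Face := inferInstanceAs (Fintype (Quotient _))
    rw [Nat.card_eq_fintype_card, ← Finset.card_univ, ← Finset.card_univ,
      Finset.card_eq_sum_card_fiberwise (f := fun d : G.Dart => (Quotient.mk _ d : R.Face))
        (t := Finset.univ) (by simp)]
    refine Finset.sum_const_nat fun f _ => ?_
    induction f using Quotient.inductionOn with | _ d => ?_
    rw [← h6 d, ← Equiv.Perm.card_sameCycle_eq_minimalPeriod]
    congr 1
    ext e
    simp only [Finset.mem_filter, Finset.mem_univ, true_and]
    exact Quotient.eq.trans ⟨fun h => h.symm, fun h => h.symm⟩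
  have hp := hG.plane
  unfold IsSpherical at hp
  rw [Nat.card_eq_fintype_card, Nat.card_eq_fintype_card, ← SimpleGraph.edgeFinset_card] at hp
  omega

end RotationSystem

/-- The labels around a closed walk in a hypercube of length four in which consecutive labels are
different. -/
theorem square_word {J : Type*} [DecidableEq J] {l₀ l₁ l₂ l₃ : J}
    (h : ∀ j, (decide (j = l₀) ^^ decide (j = l₁) ^^ decide (j = l₂) ^^ decide (j = l₃)) = false)
    (h₀ : l₀ ≠ l₁) (h₁ : l₁ ≠ l₂) (h₃ : l₃ ≠ l₀) : l₂ = l₀ ∧ l₃ = l₁ := by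
  have a := h l₀
  have b := h l₁
  grind

/-- The labels around a closed walk in a hypercube of length six in which consecutive labels are
different. -/
theorem hexagon_word {J : Type*} [DecidableEq J] {l₀ l₁ l₂ l₃ l₄ l₅ : J}
    (h : ∀ j, (decide (j = l₀) ^^ decide (j = l₁) ^^ decide (j = l₂) ^^ decide (j = l₃) ^^
      decide (j = l₄) ^^ decide (j = l₅)) = false)
    (h₀ : l₀ ≠ l₁) (h₁ : l₁ ≠ l₂) (h₂ : l₂ ≠ l₃) (h₃ : l₃ ≠ l₄) (h₄ : l₄ ≠ l₅) (h₅ : l₅ ≠ l₀) :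
    ∃ c, c ≠ l₀ ∧ c ≠ l₁ ∧ ((l₂ = c ∧ l₃ = l₀ ∧ l₄ = l₁ ∧ l₅ = c) ∨
      (l₂ = l₀ ∧ l₃ = c ∧ l₄ = l₁ ∧ l₅ = c) ∨ (l₂ = c ∧ l₃ = l₀ ∧ l₄ = c ∧ l₅ = l₁) ∨
      (l₂ = c ∧ l₃ = l₁ ∧ l₄ = l₀ ∧ l₅ = c)) := by
  have a := h l₀
  have b := h l₁
  have c := h l₂
  have d := h l₃
  have e := h l₄
  by_cases h20 : l₂ = l₀
  · refine ⟨l₃, ?_⟩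
    grind
  · refine ⟨l₂, ?_⟩
    grind

/-- A cubic map with faces of length four and six whose graph is an isometric subgraph of a
hypercube: `pos v` is the point of the hypercube that belongs to the vertex `v`, and `label d` is
the coordinate in which the ends of the dart `d` differ. -/
structure Labelling {V : Type*} {G : SimpleGraph V} (R : RotationSystem G) (m : ℕ) where
  pos : V → Fin m → Bool
  label : G.Dart → Fin m
  connected : G.Connected
  pos_injective : Function.Injective pos
  pos_snd : ∀ d j, pos d.snd j = (pos d.fst j ^^ decide (j = label d))
  adj_of_differ : ∀ v w j, (∀ i, pos v i ≠ pos w i ↔ i = j) → G.Adj v w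
  exists_towards : ∀ v w, v ≠ w → ∃ d : G.Dart, d.fst = v ∧ pos v (label d) ≠ pos w (label d)
  next_next_next : ∀ d, R.next (R.next (R.next d)) = d
  next_ne : ∀ d, R.next d ≠ d
  next_next_ne : ∀ d, R.next (R.next d) ≠ d
  eq_or_next_or_next : ∀ {d e : G.Dart}, e.fst = d.fst →
    e = d ∨ e = R.next d ∨ e = R.next (R.next d)
  face : ∀ d, R.facePerm^[4] d = d ∨ R.facePerm^[6] d = d

namespace IsGraphFourN

variable {V : Type*} [Fintype V] {G : SimpleGraph V} [DecidableRel G.Adj] {R : RotationSystem G}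

theorem nonempty_labelling (hG : IsGraphFourN G R) {m : ℕ} (φ : V → Fin m → Bool)
    (hφ : ∀ x y, hammingDist (φ x) (φ y) = G.dist x y) : Nonempty (Labelling R m) := by
  have hlab : ∀ d : G.Dart, ∃ j, ∀ i, φ d.fst i ≠ φ d.snd i ↔ i = j := fun d => by
    have h : hammingDist (φ d.fst) (φ d.snd) = 1 := by
      rw [hφ, SimpleGraph.dist_eq_one_iff_adj]
      exact d.adj
    obtain ⟨j, hj⟩ := Finset.card_eq_one.1 h
    exact ⟨j, fun i => by simpa using Finset.ext_iff.1 hj i⟩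
  choose label hlabel using hlab
  have hsnd : ∀ d j, φ d.snd j = (φ d.fst j ^^ decide (j = label d)) := fun d j => by
    have := hlabel d j
    by_cases h : j = label d
    · have := this.2 h
      simp only [h, decide_true, Bool.xor_true]
      rw [h] at this
      revert this
      cases φ d.fst (label d) <;> cases φ d.snd (label d) <;> simp
    · have := this.not.2 h
      simp only [not_not] at this
      simp [h, this]
  refine ⟨⟨φ, label, hG.connected, fun v w h => ?_, hsnd, fun v w j h => ?_, fun v w h => ?_,
    R.next_next_next hG.trivalent, R.next_ne hG.trivalent, R.next_next_ne hG.trivalent,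
    R.eq_or_next_or_next hG.trivalent, fun d => ?_⟩⟩
  · have := hφ v w
    rw [h, hammingDist_self] at this
    exact (hG.connected.dist_eq_zero_iff).1 this.symm
  · rw [← SimpleGraph.dist_eq_one_iff_adj, ← hφ]
    refine Finset.card_eq_one.2 ⟨j, ?_⟩
    ext i
    simpa using h i
  · obtain ⟨p, hp⟩ := hG.connected.exists_walk_length_eq_dist v w
    cases p with
    | nil => exact absurd rfl h
    | @cons _ u _ hvu q =>
      refine ⟨⟨(v, u), hvu⟩, rfl, fun heq => ?_⟩
      have hlt : G.dist u w < G.dist v w := by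
        rw [← hp, SimpleGraph.Walk.length_cons]
        exact Nat.lt_succ_of_le (SimpleGraph.dist_le q)
      rw [← hφ, ← hφ] at hlt
      refine absurd (Finset.card_le_card fun i hi => ?_) (not_le.2 hlt)
      have hs := hsnd ⟨(v, u), hvu⟩ i
      simp only [Finset.mem_filter, Finset.mem_univ, true_and] at hi ⊢
      by_cases hil : i = label ⟨(v, u), hvu⟩
      · exact absurd (hil ▸ heq) hi
      · simp only [hil, decide_false, Bool.xor_false] at hs
        exact hs ▸ hi
  · have h := Function.iterate_minimalPeriod (f := R.facePerm) (x := d)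
    exact (hG.faces d).imp (fun hd => by rwa [hd] at h) (fun hd => by rwa [hd] at h)

end IsGraphFourN

namespace Labelling

variable {V : Type*} {G : SimpleGraph V} {R : RotationSystem G} {m : ℕ} (Λ : Labelling R m)

theorem label_symm (d : G.Dart) : Λ.label d.symm = Λ.label d := by
  have h := Λ.pos_snd d (Λ.label d)
  have h' := Λ.pos_snd d.symm (Λ.label d)
  by_contra hne
  have h'' : decide (Λ.label d = Λ.label d.symm) = false := by simpa using fun h => hne h.symm
  simp only [decide_true, Bool.xor_true] at h
  rw [h'', Bool.xor_false] at h'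
  simp only [SimpleGraph.Dart.symm, Prod.fst_swap, Prod.snd_swap] at h'
  rw [h] at h'
  simp at h'

theorem dart_eq {d e : G.Dart} (h : d.fst = e.fst) (hl : Λ.label d = Λ.label e) : d = e := by
  refine SimpleGraph.Dart.ext d e (Prod.ext h (Λ.pos_injective (funext fun j => ?_)))
  exact (Λ.pos_snd d j).trans (by rw [h, hl]; exact (Λ.pos_snd e j).symm)

theorem label_next_ne (d : G.Dart) : Λ.label (R.next d) ≠ Λ.label d := fun h =>
  Λ.next_ne d (Λ.dart_eq (R.next_fst d) h)

theorem label_facePerm_ne (d : G.Dart) : Λ.label d ≠ Λ.label (R.facePerm d) := fun h =>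
  Λ.label_next_ne d.symm (by rw [Λ.label_symm, h]; rfl)

theorem pos_facePerm_fst (d : G.Dart) (j : Fin m) :
    Λ.pos (R.facePerm d).fst j = (Λ.pos d.fst j ^^ decide (j = Λ.label d)) := by
  rw [R.facePerm_fst, Λ.pos_snd]

theorem square_labels {d : G.Dart} (h : R.facePerm^[4] d = d) :
    Λ.label (R.facePerm^[2] d) = Λ.label d ∧
      Λ.label (R.facePerm^[3] d) = Λ.label (R.facePerm d) := by
  refine square_word (fun j => ?_) (Λ.label_facePerm_ne _) (Λ.label_facePerm_ne _) ?_
  · have := congrArg (fun e : G.Dart => Λ.pos e.fst j) h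
    simp only [Function.iterate_succ_apply', Function.iterate_zero, id, pos_facePerm_fst,
      Bool.xor_assoc] at this ⊢
    exact (by decide : ∀ a b : Bool, (a ^^ b) = a → b = false) _ _ this
  · conv_rhs => rw [← h]
    exact Λ.label_facePerm_ne _

theorem hexagon_labels {d : G.Dart} (h : R.facePerm^[6] d = d) :
    ∃ c, c ≠ Λ.label d ∧ c ≠ Λ.label (R.facePerm d) ∧
      ((Λ.label (R.facePerm^[2] d) = c ∧ Λ.label (R.facePerm^[3] d) = Λ.label d ∧
        Λ.label (R.facePerm^[4] d) = Λ.label (R.facePerm d) ∧ Λ.label (R.facePerm^[5] d) = c) ∨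
      (Λ.label (R.facePerm^[2] d) = Λ.label d ∧ Λ.label (R.facePerm^[3] d) = c ∧
        Λ.label (R.facePerm^[4] d) = Λ.label (R.facePerm d) ∧ Λ.label (R.facePerm^[5] d) = c) ∨
      (Λ.label (R.facePerm^[2] d) = c ∧ Λ.label (R.facePerm^[3] d) = Λ.label d ∧
        Λ.label (R.facePerm^[4] d) = c ∧ Λ.label (R.facePerm^[5] d) = Λ.label (R.facePerm d)) ∨
      (Λ.label (R.facePerm^[2] d) = c ∧ Λ.label (R.facePerm^[3] d) = Λ.label (R.facePerm d) ∧
        Λ.label (R.facePerm^[4] d) = Λ.label d ∧ Λ.label (R.facePerm^[5] d) = c)) := by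
  refine hexagon_word (fun j => ?_) (Λ.label_facePerm_ne _) (Λ.label_facePerm_ne _)
    (Λ.label_facePerm_ne _) (Λ.label_facePerm_ne _) (Λ.label_facePerm_ne _) ?_
  · have := congrArg (fun e : G.Dart => Λ.pos e.fst j) h
    simp only [Function.iterate_succ_apply', Function.iterate_zero, id, pos_facePerm_fst,
      Bool.xor_assoc] at this ⊢
    exact (by decide : ∀ a b : Bool, (a ^^ b) = a → b = false) _ _ this
  · conv_rhs => rw [← h]
    exact Λ.label_facePerm_ne _

end Labelling

/-- A base point together with a numbering of some of the coordinates of the hypercube. -/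
structure Labelling.Chart {V : Type*} {G : SimpleGraph V} {R : RotationSystem G} {m : ℕ}
    (Λ : Labelling R m) (k : ℕ) where
  base : V
  coord : ℕ → Fin m
  coord_injOn : Set.InjOn coord (Set.Iio k)

namespace Labelling.Chart

variable {V : Type*} {G : SimpleGraph V} {R : RotationSystem G} {m k : ℕ} {Λ : Labelling R m}

/-- Number one more coordinate. -/
def extend (b : Λ.Chart k) (j : Fin m) (hj : ∀ i < k, b.coord i ≠ j) : Λ.Chart (k + 1) where
  base := b.base
  coord := Function.update b.coord k j
  coord_injOn := by
    intro a ha l hl h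
    simp only [Set.mem_Iio] at ha hl
    rcases Nat.lt_succ_iff_lt_or_eq.1 ha with ha | rfl <;>
      rcases Nat.lt_succ_iff_lt_or_eq.1 hl with hl | rfl
    · rw [Function.update_of_ne ha.ne, Function.update_of_ne hl.ne] at h
      exact b.coord_injOn ha hl h
    · rw [Function.update_of_ne ha.ne, Function.update_self] at h
      exact absurd h (hj a ha)
    · rw [Function.update_of_ne hl.ne, Function.update_self] at h
      exact absurd h.symm (hj l hl)
    · rfl

variable (c : Λ.Chart k)

/-- `x` is the code of the vertex `v`: its binary digits tell in which of the numbered coordinates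
`v` differs from the base point, and `v` does not differ from it in any other coordinate. -/
structure Encodes (x : ℕ) (v : V) : Prop where
  lt : x < 2 ^ k
  testBit : ∀ i < k, x.testBit i = (Λ.pos v (c.coord i) ^^ Λ.pos c.base (c.coord i))
  pos_eq : ∀ j, (∀ i < k, c.coord i ≠ j) → Λ.pos v j = Λ.pos c.base j

variable {c} {x y : ℕ} {v w : V}

theorem Encodes.testBit_of_le (h : c.Encodes x v) {i : ℕ} (hi : k ≤ i) : x.testBit i = false :=
  Nat.testBit_lt_two_pow (h.lt.trans_le (Nat.pow_le_pow_right two_pos hi))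

theorem Encodes.vertex_unique (hv : c.Encodes x v) (hw : c.Encodes x w) : v = w := by
  refine Λ.pos_injective (funext fun j => ?_)
  by_cases hj : ∃ i < k, c.coord i = j
  · obtain ⟨i, hi, rfl⟩ := hj
    have := (hv.testBit i hi).symm.trans (hw.testBit i hi)
    simpa using this
  · push Not at hj
    rw [hv.pos_eq j hj, hw.pos_eq j hj]

theorem Encodes.code_unique (hx : c.Encodes x v) (hy : c.Encodes y v) : x = y := by
  refine Nat.eq_of_testBit_eq fun i => ?_
  by_cases hi : i < k
  · rw [hx.testBit i hi, hy.testBit i hi]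
  · rw [hx.testBit_of_le (not_lt.1 hi), hy.testBit_of_le (not_lt.1 hi)]

theorem encodes_base : c.Encodes 0 c.base :=
  ⟨by positivity, fun i _ => by simp, fun _ _ => rfl⟩

theorem Encodes.step {d : G.Dart} (h : c.Encodes x d.fst) {i : ℕ} (hi : i < k)
    (hd : Λ.label d = c.coord i) : c.Encodes (x ^^^ 2 ^ i) d.snd := by
  refine ⟨Nat.xor_lt_two_pow h.lt (Nat.pow_lt_pow_right one_lt_two hi), fun l hl => ?_,
    fun j hj => ?_⟩
  · rw [Nat.testBit_xor, h.testBit l hl, Λ.pos_snd, hd, Nat.testBit_two_pow]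
    have : decide (c.coord l = c.coord i) = decide (i = l) :=
      decide_eq_decide.2 ⟨fun h => (c.coord_injOn hl hi h).symm, fun h => h ▸ rfl⟩
    rw [this]
    grind
  · rw [Λ.pos_snd, h.pos_eq j hj, hd, decide_eq_false fun h => hj i hi h.symm, Bool.xor_false]

theorem Encodes.testBit_xor (hx : c.Encodes x v) (hy : c.Encodes y w) {i : ℕ} (hi : i < k) :
    (x ^^^ y).testBit i = true ↔ Λ.pos v (c.coord i) ≠ Λ.pos w (c.coord i) := by
  rw [Nat.testBit_xor, hx.testBit i hi, hy.testBit i hi]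
  cases Λ.pos v (c.coord i) <;> cases Λ.pos w (c.coord i) <;> cases Λ.pos c.base (c.coord i) <;>
    simp

theorem Encodes.adj_iff (hx : c.Encodes x v) (hy : c.Encodes y w) :
    G.Adj v w ↔ ∃ i < k, x ^^^ y = 2 ^ i := by
  constructor
  · intro hvw
    have hs := Λ.pos_snd ⟨(v, w), hvw⟩
    by_cases hj : ∃ i < k, c.coord i = Λ.label ⟨(v, w), hvw⟩
    · obtain ⟨i, hi, hi'⟩ := hj
      refine ⟨i, hi, ?_⟩
      rw [hy.code_unique (Encodes.step (d := ⟨(v, w), hvw⟩) hx hi hi'.symm), ← Nat.xor_assoc, Nat.xor_self,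
        Nat.zero_xor]
    · push Not at hj
      have := hs (Λ.label ⟨(v, w), hvw⟩)
      simp only [hx.pos_eq _ hj, hy.pos_eq _ hj] at this
      simp at this
  · rintro ⟨i, hi, h⟩
    refine Λ.adj_of_differ v w (c.coord i) fun j => ?_
    by_cases hj : ∃ l < k, c.coord l = j
    · obtain ⟨l, hl, rfl⟩ := hj
      rw [← hx.testBit_xor hy hl, h, Nat.testBit_two_pow, decide_eq_true_iff]
      exact ⟨fun h => h ▸ rfl, fun h => (c.coord_injOn hl hi h).symm⟩
    · push Not at hj
      simp only [hx.pos_eq _ hj, hy.pos_eq _ hj, ne_eq, not_true_eq_false, false_iff]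
      exact fun h => hj i hi h.symm

theorem extend_coord_of_lt {j : Fin m} (hj : ∀ i < k, c.coord i ≠ j) {i : ℕ} (hi : i < k) :
    (c.extend j hj).coord i = c.coord i :=
  Function.update_of_ne hi.ne _ _

theorem extend_coord_self {j : Fin m} (hj : ∀ i < k, c.coord i ≠ j) :
    (c.extend j hj).coord k = j :=
  Function.update_self _ _ _

theorem Encodes.extend (h : c.Encodes x v) {j : Fin m} (hj : ∀ i < k, c.coord i ≠ j) :
    (c.extend j hj).Encodes x v := by
  refine ⟨h.lt.trans (Nat.pow_lt_pow_right one_lt_two k.lt_succ_self), fun i hi => ?_,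
    fun l hl => h.pos_eq l fun i hi => ?_⟩
  · rcases Nat.lt_succ_iff_lt_or_eq.1 hi with hi | rfl
    · rw [extend_coord_of_lt hj hi, h.testBit i hi]
      rfl
    · rw [h.testBit_of_le le_rfl, extend_coord_self hj, h.pos_eq j hj]
      exact (Bool.xor_self _).symm
  · rw [← extend_coord_of_lt hj hi]
    exact hl i (hi.trans k.lt_succ_self)

end Labelling.Chart

namespace Patch

theorem mem_of_findStar {x : ℕ} {s : PatchStar} :
    ∀ {l : List PatchStar}, findStar x l = some s → s ∈ l ∧ s.code = x
  | [], h => by simp [findStar] at h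
  | t :: l, h => by
    rw [findStar] at h
    cases ht : Nat.beq t.code x with
    | true =>
      rw [ht] at h
      obtain rfl : t = s := by simpa using h
      exact ⟨List.mem_cons_self, Nat.eq_of_beq_eq_true ht⟩
    | false =>
      rw [ht] at h
      exact (mem_of_findStar (l := l) h).imp_left (List.mem_cons_of_mem t)

theorem mem_of_findCorner {x : ℕ} {s : PatchCorner} :
    ∀ {l : List PatchCorner}, findCorner x l = some s → s ∈ l ∧ s.code = x
  | [], h => by simp [findCorner] at h
  | t :: l, h => by
    rw [findCorner] at h
    cases ht : Nat.beq t.code x with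
    | true =>
      rw [ht] at h
      obtain rfl : t = s := by simpa using h
      exact ⟨List.mem_cons_self, Nat.eq_of_beq_eq_true ht⟩
    | false =>
      rw [ht] at h
      exact (mem_of_findCorner (l := l) h).imp_left (List.mem_cons_of_mem t)

theorem mem_of_mem_dropCode {x : ℕ} {s : PatchCorner} :
    ∀ {l : List PatchCorner}, s ∈ dropCode x l → s ∈ l
  | [], h => h
  | t :: l, h => by
    rw [dropCode] at h
    cases ht : Nat.beq t.code x with
    | true =>
      rw [ht] at h
      exact List.mem_cons_of_mem t h
    | false =>
      rw [ht] at h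
      rcases List.mem_cons.1 h with rfl | h
      · exact List.mem_cons_self
      · exact List.mem_cons_of_mem t (mem_of_mem_dropCode h)

theorem beq_eq_false_of_ne {a b : ℕ} (h : a ≠ b) : Nat.beq a b = false :=
  Bool.eq_false_iff.2 fun h' => h (Nat.eq_of_beq_eq_true h')

theorem memCode_iff {x : ℕ} : ∀ {l : List ℕ}, memCode x l = true ↔ x ∈ l
  | [] => by simp [memCode]
  | y :: l => by rw [memCode, Bool.or_eq_true, Nat.beq_eq, memCode_iff, List.mem_cons]

end Patch

namespace Labelling.Chart

variable {V : Type*} {G : SimpleGraph V} {R : RotationSystem G} {m k : ℕ} {Λ : Labelling R m}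
  (c : Λ.Chart k)

/-- At the vertex with code `x`, the edge with the coordinate numbered `q` follows the edge with
the coordinate numbered `p`. -/
def CornerAt (x p q : ℕ) : Prop :=
  p < k ∧ q < k ∧ ∃ d : G.Dart, c.Encodes x d.fst ∧ Λ.label d = c.coord p ∧
    Λ.label (R.next d) = c.coord q

/-- The edges at the vertex with code `x` have, in rotation order, the coordinates numbered `p`,
`q` and `r`. -/
def StarAt (x p q r : ℕ) : Prop :=
  p < k ∧ q < k ∧ r < k ∧ ∃ d : G.Dart, c.Encodes x d.fst ∧ Λ.label d = c.coord p ∧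
    Λ.label (R.next d) = c.coord q ∧ Λ.label (R.next (R.next d)) = c.coord r

/-- Everything that the patch `S` says is true. -/
structure Holds (S : Patch) : Prop where
  labels : S.labels = k
  corners : ∀ s ∈ S.corners, c.CornerAt s.code s.left s.right
  stars : ∀ s ∈ S.stars, c.StarAt s.code s.fst s.snd s.trd
  agenda : ∀ s ∈ S.agenda, c.CornerAt s.code s.left s.right

/-- The labels on the boundary walk of the face of `d` after `d` are the given ones. -/
def Follows : G.Dart → List ℕ → Prop
  | _, [] => True
  | d, q :: l => q < k ∧ Λ.label (R.facePerm d) = c.coord q ∧ Follows (R.facePerm d) l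

variable {c} {S : Patch} {x p q r : ℕ}

theorem coord_inj {i j : ℕ} (hi : i < k) (hj : j < k) (h : c.coord i = c.coord j) : i = j :=
  c.coord_injOn hi hj h

theorem CornerAt.extend (h : c.CornerAt x p q) {j : Fin m} (hj : ∀ i < k, c.coord i ≠ j) :
    (c.extend j hj).CornerAt x p q := by
  obtain ⟨hp, hq, d, hd, hdp, hdq⟩ := h
  refine ⟨hp.trans k.lt_succ_self, hq.trans k.lt_succ_self, d, hd.extend hj, ?_, ?_⟩
  · rwa [extend_coord_of_lt hj hp]
  · rwa [extend_coord_of_lt hj hq]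

theorem StarAt.extend (h : c.StarAt x p q r) {j : Fin m} (hj : ∀ i < k, c.coord i ≠ j) :
    (c.extend j hj).StarAt x p q r := by
  obtain ⟨hp, hq, hr, d, hd, hdp, hdq, hdr⟩ := h
  refine ⟨hp.trans k.lt_succ_self, hq.trans k.lt_succ_self, hr.trans k.lt_succ_self, d,
    hd.extend hj, ?_, ?_, ?_⟩
  · rwa [extend_coord_of_lt hj hp]
  · rwa [extend_coord_of_lt hj hq]
  · rwa [extend_coord_of_lt hj hr]

theorem Holds.extend (h : c.Holds S) {j : Fin m} (hj : ∀ i < k, c.coord i ≠ j) :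
    (c.extend j hj).Holds ⟨k + 1, S.corners, S.stars, S.agenda⟩ :=
  ⟨rfl, fun s hs => (h.corners s hs).extend hj, fun s hs => (h.stars s hs).extend hj,
    fun s hs => (h.agenda s hs).extend hj⟩

theorem StarAt.ne (h : c.StarAt x p q r) : p ≠ q ∧ q ≠ r ∧ r ≠ p := by
  obtain ⟨hp, hq, hr, d, hd, hdp, hdq, hdr⟩ := h
  refine ⟨?_, ?_, ?_⟩ <;> rintro rfl
  · exact Λ.label_next_ne d (hdq.trans hdp.symm)
  · exact Λ.label_next_ne _ (hdr.trans hdq.symm)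
  · refine Λ.label_next_ne (R.next (R.next d)) ?_
    rw [Λ.next_next_next, hdp, hdr]

theorem StarAt.rotate (h : c.StarAt x p q r) : c.StarAt x q r p := by
  obtain ⟨hp, hq, hr, d, hd, hdp, hdq, hdr⟩ := h
  exact ⟨hq, hr, hp, R.next d, (R.next_fst d).symm ▸ hd, hdq, hdr, by rwa [Λ.next_next_next]⟩

theorem StarAt.cornerAt (h : c.StarAt x p q r) : c.CornerAt x p q := by
  obtain ⟨hp, hq, hr, d, hd, hdp, hdq, hdr⟩ := h
  exact ⟨hp, hq, d, hd, hdp, hdq⟩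

theorem StarAt.corner_cases {a b : ℕ} (h : c.StarAt x p q r) (h' : c.CornerAt x a b) :
    (a = p ∧ b = q) ∨ (a = q ∧ b = r) ∨ (a = r ∧ b = p) := by
  obtain ⟨hp, hq, hr, d, hd, hdp, hdq, hdr⟩ := h
  obtain ⟨ha, hb, e, he, hea, heb⟩ := h'
  rcases Λ.eq_or_next_or_next (he.vertex_unique hd) with rfl | rfl | rfl
  · exact Or.inl ⟨coord_inj ha hp (hea.symm.trans hdp), coord_inj hb hq (heb.symm.trans hdq)⟩
  · exact Or.inr (Or.inl
      ⟨coord_inj ha hq (hea.symm.trans hdq), coord_inj hb hr (heb.symm.trans hdr)⟩)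
  · rw [Λ.next_next_next] at heb
    exact Or.inr (Or.inr
      ⟨coord_inj ha hr (hea.symm.trans hdr), coord_inj hb hp (heb.symm.trans hdp)⟩)

/-- Two corners at the same vertex are equal or determine the star of the vertex. -/
theorem CornerAt.corner_cases {a b : ℕ} (h : c.CornerAt x p q) (h' : c.CornerAt x a b) :
    (a = p ∧ b = q) ∨ (a = q ∧ c.StarAt x p a b) ∨ (b = p ∧ c.StarAt x a b q) := by
  obtain ⟨hp, hq, d, hd, hdp, hdq⟩ := h
  obtain ⟨ha, hb, e, he, hea, heb⟩ := h'
  rcases Λ.eq_or_next_or_next (he.vertex_unique hd) with rfl | rfl | rfl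
  · exact Or.inl ⟨coord_inj ha hp (hea.symm.trans hdp), coord_inj hb hq (heb.symm.trans hdq)⟩
  · exact Or.inr (Or.inl
      ⟨coord_inj ha hq (hea.symm.trans hdq), hp, ha, hb, d, hd, hdp, hea, heb⟩)
  · have heb' := heb
    rw [Λ.next_next_next] at heb'
    exact Or.inr (Or.inr ⟨coord_inj hb hp (heb'.symm.trans hdp), ha, hb, hq, _, he, hea, heb,
      by rwa [Λ.next_next_next]⟩)

theorem StarAt.sees {s : PatchStar} (hs : c.StarAt s.code s.fst s.snd s.trd) {y : ℕ} {w : V}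
    (hw : c.Encodes y w) : s.sees y = true := by
  obtain ⟨hp, hq, hr, d, hd, hdp, hdq, hdr⟩ := hs
  unfold PatchStar.sees
  rw [Bool.or_eq_true, Nat.beq_eq, Bool.not_eq_true', ← Bool.not_eq_true, Nat.beq_eq]
  by_cases hvw : d.fst = w
  · exact Or.inl (hd.code_unique (hvw ▸ hw))
  right
  intro h0
  obtain ⟨e, he, hew⟩ := Λ.exists_towards _ _ hvw
  have key : ∀ i < k, Λ.label e = c.coord i → s.mask.testBit i = true → False := by
    intro i hi hei hmask
    rw [hei] at hew
    have := congrArg (Nat.testBit · i) h0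
    simp only [Nat.testBit_and, hmask, (hd.testBit_xor hw hi).2 hew, Nat.zero_testBit] at this
    exact absurd this (by decide)
  rcases Λ.eq_or_next_or_next he with rfl | rfl | rfl
  · exact key _ hp hdp (by simp [PatchStar.mask])
  · exact key _ hq hdq (by simp [PatchStar.mask])
  · exact key _ hr hdr (by simp [PatchStar.mask])

theorem Holds.addStar (hS : c.Holds S) {s : PatchStar} (hs : c.StarAt s.code s.fst s.snd s.trd)
    (h : c.CornerAt s.code p q) : ∃ T, S.addStar s p q = some T ∧ c.Holds T := by
  have hsee : S.seenBy s = true := by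
    unfold Patch.seenBy
    simp only [List.all_eq_true, Bool.and_eq_true]
    refine ⟨fun t ht => ?_, fun t ht => ?_⟩
    · obtain ⟨_, _, _, d, hd, _⟩ := hS.stars t ht
      exact hs.sees hd
    · obtain ⟨_, _, d, hd, _⟩ := hS.corners t ht
      exact hs.sees hd
  rw [Patch.addStar, hsee, cond_true]
  refine ⟨_, rfl, hS.labels,
    fun t ht => hS.corners t (Patch.mem_of_mem_dropCode ht), fun t ht => ?_, fun t ht => ?_⟩
  · rcases List.mem_cons.1 ht with rfl | ht
    · exact hs
    · exact hS.stars t ht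
  · rcases List.mem_cons.1 ht with rfl | ht
    · exact h
    · exact hS.agenda t ht

theorem Holds.insert (hS : c.Holds S) (h : c.CornerAt x p q) :
    ∃ T, S.insert x p q = some T ∧ c.Holds T := by
  unfold Patch.insert
  cases hs : Patch.findStar x S.stars with
  | some s =>
    obtain ⟨hsm, rfl⟩ := Patch.mem_of_findStar hs
    refine ⟨S, ?_, hS⟩
    have : s.follows p q = true := by
      rcases (hS.stars s hsm).corner_cases h with ⟨rfl, rfl⟩ | ⟨rfl, rfl⟩ | ⟨rfl, rfl⟩ <;>
        simp [PatchStar.follows]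
    simp [this]
  | none =>
    cases hc : Patch.findCorner x S.corners with
    | none =>
      have hsee : (S.stars.all fun s => s.sees x) = true := by
        obtain ⟨_, _, d, hd, _⟩ := h
        exact List.all_eq_true.2 fun s hs => (hS.stars s hs).sees hd
      simp only [hsee, cond_true]
      refine ⟨_, rfl, hS.labels, fun s hs => ?_, hS.stars, hS.agenda⟩
      rcases List.mem_cons.1 hs with rfl | hs
      · exact h
      · exact hS.corners s hs
    | some s =>
      obtain ⟨hsm, rfl⟩ := Patch.mem_of_findCorner hc
      rcases (hS.corners s hsm).corner_cases h with ⟨rfl, rfl⟩ | ⟨rfl, h⟩ | ⟨rfl, h⟩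
      · exact ⟨S, by simp, hS⟩
      · obtain ⟨h₁, h₂, h₃⟩ := h.ne
        simpa [Patch.beq_eq_false_of_ne h₁, Patch.beq_eq_false_of_ne h₃.symm] using
          hS.addStar (s := ⟨s.code, s.left, s.right, q⟩) h h.rotate.rotate.cornerAt
      · obtain ⟨h₁, h₂, h₃⟩ := h.ne
        simpa [Patch.beq_eq_false_of_ne h₁.symm, Patch.beq_eq_false_of_ne h₃] using
          hS.addStar (s := ⟨s.code, p, s.left, s.right⟩) h h.rotate.rotate.cornerAt

theorem Holds.insertWalk {l : List ℕ} : ∀ {S : Patch} {x p : ℕ} {d : G.Dart}, c.Holds S → p < k →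
    c.Encodes x d.snd → Λ.label d = c.coord p → c.Follows d l →
    ∃ T, S.insertWalk x p l = some T ∧ c.Holds T := by
  induction l with
  | nil => exact fun hS _ _ _ _ => ⟨_, rfl, hS⟩
  | cons q l ih =>
    intro S x p d hS hp hx hd ⟨hq, hdq, hl⟩
    obtain ⟨T, hT, hT'⟩ := hS.insert (x := x) (p := p) (q := q)
      ⟨hp, hq, d.symm, hx, by rwa [Λ.label_symm], hdq⟩
    have hx' : c.Encodes (x ^^^ 2 ^ q) (R.facePerm d).snd :=
      Encodes.step (by rwa [R.facePerm_fst]) hq hdq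
    obtain ⟨T', hT''⟩ := ih hT' hq hx' hdq hl
    exact ⟨T', by rw [Patch.insertWalk, hT]; exact hT''.1, hT''.2⟩

/-- The vertices of the graph are the vertices with a code in the list `K`. -/
def Exhausts (c : Λ.Chart k) (K : List ℕ) : Prop :=
  (∀ v, ∃ x ∈ K, c.Encodes x v) ∧ ∀ x ∈ K, ∃ v, c.Encodes x v

theorem Holds.exists_star_of_closed (hS : c.Holds S) (h : S.closed = true) (v : V) :
    ∃ s ∈ S.stars, c.Encodes s.code v := by
  unfold Patch.closed at h
  simp only [Bool.and_eq_true, List.all_eq_true, Option.isSome_iff_exists, Bool.not_eq_true',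
    List.isEmpty_eq_false_iff] at h
  have hstep : ∀ v w, G.Adj v w → (∃ s ∈ S.stars, c.Encodes s.code v) →
      ∃ s ∈ S.stars, c.Encodes s.code w := by
    rintro v w hvw ⟨s, hs, hsv⟩
    obtain ⟨hp, hq, hr, d, hd, hdp, hdq, hdr⟩ := hS.stars s hs
    obtain rfl := hd.vertex_unique hsv
    have key : ∀ e : G.Dart, e.fst = d.fst → ∀ i < k, Λ.label e = c.coord i →
        (∃ t, Patch.findStar (s.code ^^^ 2 ^ i) S.stars = some t) →
        ∃ s ∈ S.stars, c.Encodes s.code e.snd := by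
      rintro e he i hi hei ⟨t, ht⟩
      obtain ⟨htm, htc⟩ := Patch.mem_of_findStar ht
      exact ⟨t, htm, htc ▸ Encodes.step (he ▸ hsv) hi hei⟩
    obtain ⟨⟨h₁, h₂⟩, h₃⟩ := h.2 s hs
    have hw : ∀ e : G.Dart, e = ⟨(d.fst, w), hvw⟩ → e.snd = w := by rintro _ rfl; rfl
    rcases Λ.eq_or_next_or_next (d := d) (e := ⟨(d.fst, w), hvw⟩) rfl with he | he | he
    · rw [← hw _ he.symm]
      exact key _ rfl _ hp hdp h₁
    · rw [← hw _ he.symm]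
      exact key _ (R.next_fst d) _ hq hdq h₂
    · rw [← hw _ he.symm]
      exact key _ ((R.next_fst _).trans (R.next_fst d)) _ hr hdr h₃
  obtain ⟨s, hs⟩ := List.exists_mem_of_ne_nil _ h.1.2
  obtain ⟨_, _, _, d, hd, _⟩ := hS.stars s hs
  obtain ⟨p⟩ := Λ.connected d.fst v
  have : ∀ {u v : V} (_ : G.Walk u v), (∃ s ∈ S.stars, c.Encodes s.code u) →
      ∃ s ∈ S.stars, c.Encodes s.code v := by
    intro u v p
    induction p with
    | nil => exact id
    | cons huv p ih => exact fun hu => ih (hstep _ _ huv hu)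
  exact this p ⟨s, hs, hd⟩

theorem Holds.exhausts (hS : c.Holds S) (h : S.closed = true) {K : List ℕ}
    (hK : S.hasCodes K = true) : c.Exhausts K := by
  unfold Patch.hasCodes at hK
  simp only [Bool.and_eq_true, List.all_eq_true, Option.isSome_iff_exists,
    Patch.memCode_iff] at hK
  refine ⟨fun v => ?_, fun x hx => ?_⟩
  · obtain ⟨s, hs, hsv⟩ := hS.exists_star_of_closed h v
    exact ⟨_, hK.1 s hs, hsv⟩
  · obtain ⟨t, ht⟩ := hK.2 x hx
    obtain ⟨htm, rfl⟩ := Patch.mem_of_findStar ht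
    obtain ⟨_, _, _, d, hd, _⟩ := hS.stars t htm
    exact ⟨_, hd⟩

theorem follows_square {d : G.Dart} (hp : p < k) (hq : q < k) (hdp : Λ.label d = c.coord p)
    (hdq : Λ.label (R.facePerm d) = c.coord q) (h : R.facePerm^[4] d = d) :
    c.Follows d [q, p, q, p] := by
  obtain ⟨h₂, h₃⟩ := Λ.square_labels h
  exact ⟨hq, hdq, hp, h₂.trans hdp, hq, h₃.trans hdq, hp, (congrArg Λ.label h).trans hdp, trivial⟩

theorem follows_hexagon {d : G.Dart} (hp : p < k) (hq : q < k) (hdp : Λ.label d = c.coord p)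
    (hdq : Λ.label (R.facePerm d) = c.coord q) (h : R.facePerm^[6] d = d) {j : Fin m}
    (hw : (Λ.label (R.facePerm^[2] d) = j ∧ Λ.label (R.facePerm^[3] d) = Λ.label d ∧
        Λ.label (R.facePerm^[4] d) = Λ.label (R.facePerm d) ∧ Λ.label (R.facePerm^[5] d) = j) ∨
      (Λ.label (R.facePerm^[2] d) = Λ.label d ∧ Λ.label (R.facePerm^[3] d) = j ∧
        Λ.label (R.facePerm^[4] d) = Λ.label (R.facePerm d) ∧ Λ.label (R.facePerm^[5] d) = j) ∨
      (Λ.label (R.facePerm^[2] d) = j ∧ Λ.label (R.facePerm^[3] d) = Λ.label d ∧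
        Λ.label (R.facePerm^[4] d) = j ∧ Λ.label (R.facePerm^[5] d) = Λ.label (R.facePerm d)) ∨
      (Λ.label (R.facePerm^[2] d) = j ∧ Λ.label (R.facePerm^[3] d) = Λ.label (R.facePerm d) ∧
        Λ.label (R.facePerm^[4] d) = Λ.label d ∧ Λ.label (R.facePerm^[5] d) = j))
    {i : ℕ} (hi : i < k) (hij : c.coord i = j) :
    ∃ w ∈ Patch.hexWalks p q i, c.Follows d w := by
  subst hij
  have h₆ := (congrArg Λ.label h).trans hdp
  rcases hw with ⟨h₂, h₃, h₄, h₅⟩ | ⟨h₂, h₃, h₄, h₅⟩ | ⟨h₂, h₃, h₄, h₅⟩ | ⟨h₂, h₃, h₄, h₅⟩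
  · exact ⟨[q, i, p, q, i, p], by simp [Patch.hexWalks], hq, hdq, hi, h₂, hp, h₃.trans hdp, hq,
      h₄.trans hdq, hi, h₅, hp, h₆, trivial⟩
  · exact ⟨[q, p, i, q, i, p], by simp [Patch.hexWalks], hq, hdq, hp, h₂.trans hdp, hi, h₃, hq,
      h₄.trans hdq, hi, h₅, hp, h₆, trivial⟩
  · exact ⟨[q, i, p, i, q, p], by simp [Patch.hexWalks], hq, hdq, hi, h₂, hp, h₃.trans hdp, hi,
      h₄, hq, h₅.trans hdq, hp, h₆, trivial⟩
  · exact ⟨[q, i, q, p, i, p], by simp [Patch.hexWalks], hq, hdq, hi, h₂, hq, h₃.trans hdq, hp,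
      h₄.trans hdp, hi, h₅, hp, h₆, trivial⟩

/-- If the exploration of a true patch succeeds, then the vertices of the graph have codes as in
the table. -/
theorem exists_exhausts_of_explore {table : List (List ℕ)} (n : ℕ) :
    ∀ {k : ℕ} {c : Λ.Chart k} {S : Patch}, c.Holds S → S.explore table n = true →
      ∃ K ∈ table, ∃ (k' : ℕ) (c' : Λ.Chart k'), c'.Exhausts K := by
  induction n with
  | zero => intro k c S _ h; simp [Patch.explore] at h
  | succ n ih =>
    intro k c S hS h
    rw [Patch.explore] at h
    cases hcl : S.closed with
    | true =>
      rw [hcl, cond_true, List.any_eq_true] at h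
      obtain ⟨K, hK, hK'⟩ := h
      exact ⟨K, hK, k, c, hS.exhausts hcl hK'⟩
    | false =>
      rw [hcl, cond_false] at h
      cases hag : S.agenda with
      | nil => simp [hag] at h
      | cons s A =>
        rw [hag] at h
        simp only [Bool.and_eq_true, List.all_eq_true, List.mem_range, Bool.or_eq_true] at h
        obtain ⟨hsq, hhex⟩ := h
        have hS' : c.Holds ⟨S.labels, S.corners, S.stars, A⟩ :=
          ⟨hS.labels, hS.corners, hS.stars, fun t ht => hS.agenda t (by simp [hag, ht])⟩
        obtain ⟨hp, hq, e, he, hep, heq⟩ := hS.agenda s (by simp [hag])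
        have hep' : Λ.label e.symm = c.coord s.left := by rwa [Λ.label_symm]
        rcases Λ.face e.symm with hf | hf
        · obtain ⟨T, hT, hT'⟩ := hS'.insertWalk hp (d := e.symm) he hep'
            (follows_square hp hq hep' heq hf)
          simp only [hT] at hsq
          exact ih hT' hsq
        · obtain ⟨j, hjp, hjq, hw⟩ := Λ.hexagon_labels hf
          by_cases hj : ∃ i < k, c.coord i = j
          · obtain ⟨i, hi, hij⟩ := hj
            obtain ⟨w, hw, hfw⟩ := follows_hexagon hp hq hep' heq hf hw hi hij
            obtain ⟨T, hT, hT'⟩ := hS'.insertWalk hp (d := e.symm) he hep' hfw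
            have hik : Nat.beq i S.labels = false :=
              Patch.beq_eq_false_of_ne (by rw [hS.labels]; exact hi.ne)
            rcases hhex i (by rw [hS.labels]; omega) with (h | h) | h
            · exact absurd (by rw [← hij, Nat.eq_of_beq_eq_true h, hep']) hjp
            · exact absurd (by rw [← hij, Nat.eq_of_beq_eq_true h]; exact heq.symm) hjq
            · have := h w hw
              simp only [hik, cond_false, hT] at this
              exact ih hT' this
          · push Not at hj
            have hS'' := hS'.extend hj
            have hep'' : Λ.label e.symm = (c.extend j hj).coord s.left := by
              rw [extend_coord_of_lt hj hp, hep']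
            have heq'' : Λ.label (R.facePerm e.symm) = (c.extend j hj).coord s.right := by
              rw [extend_coord_of_lt hj hq]; exact heq
            obtain ⟨w, hw, hfw⟩ := follows_hexagon (hp.trans k.lt_succ_self)
              (hq.trans k.lt_succ_self) hep'' heq'' hf hw k.lt_succ_self (extend_coord_self hj)
            obtain ⟨T, hT, hT'⟩ := hS''.insertWalk (hp.trans k.lt_succ_self) (d := e.symm)
              (he.extend hj) hep'' hfw
            rcases hhex k (by rw [hS.labels]; omega) with (h | h) | h
            · exact absurd (Nat.eq_of_beq_eq_true h) hp.ne'
            · exact absurd (Nat.eq_of_beq_eq_true h) hq.ne'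
            · have := h w hw
              simp only [hS.labels, Nat.beq_refl, cond_true, hT] at this
              exact ih hT' this

end Labelling.Chart

namespace Labelling.Chart

variable {V : Type*} {G : SimpleGraph V} {R : RotationSystem G} {m k : ℕ} {Λ : Labelling R m}
  {c : Λ.Chart k}

theorem Encodes.adj_iff_log2 {x y : ℕ} {v w : V} (hx : c.Encodes x v) (hy : c.Encodes y w) :
    G.Adj v w ↔ 2 ^ Nat.log2 (x ^^^ y) = x ^^^ y := by
  rw [hx.adj_iff hy]
  constructor
  · rintro ⟨i, -, h⟩
    rw [h, Nat.log2_two_pow]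
  · intro h
    refine ⟨_, ?_, h.symm⟩
    rw [← Nat.pow_lt_pow_iff_right one_lt_two, h]
    exact Nat.xor_lt_two_pow hx.lt hy.lt

/-- The graph is isomorphic to a graph `T` whose vertices can be numbered in such a way that
adjacency corresponds to a difference of the codes in one bit. -/
theorem Exhausts.nonempty_iso {K : List ℕ} (h : c.Exhausts K) {W : Type*} (T : SimpleGraph W)
    (f : W → ℕ) (hK : ∀ x, x ∈ K ↔ ∃ t, f t = x) (hf : ∀ s t, f s = f t → s = t)
    (hadj : ∀ s t, T.Adj s t ↔ 2 ^ Nat.log2 (f s ^^^ f t) = f s ^^^ f t) :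
    Nonempty (G ≃g T) := by
  have hex : ∀ t, ∃ v, c.Encodes (f t) v := fun t => h.2 _ ((hK _).2 ⟨t, rfl⟩)
  choose g hg using hex
  have hbij : Function.Bijective g := by
    refine ⟨fun s t hst => hf s t ((hg s).code_unique (hst ▸ hg t)), fun v => ?_⟩
    obtain ⟨x, hx, hxv⟩ := h.1 v
    obtain ⟨t, rfl⟩ := (hK x).1 hx
    exact ⟨t, (hg t).vertex_unique hxv⟩
  refine ⟨RelIso.symm ⟨Equiv.ofBijective g hbij, fun {s t} => ?_⟩⟩
  rw [hadj, Equiv.ofBijective_apply, Equiv.ofBijective_apply, (hg s).adj_iff_log2 (hg t)]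

end Labelling.Chart

/-- What is known at first around a vertex of a square. -/
def squarePatch : Patch :=
  ⟨3, [⟨1, 1, 0⟩, ⟨3, 0, 1⟩, ⟨2, 1, 0⟩], [⟨0, 0, 1, 2⟩], [⟨0, 1, 2⟩, ⟨0, 2, 0⟩]⟩

theorem Labelling.exists_holds_squarePatch {V : Type*} {G : SimpleGraph V} {R : RotationSystem G}
    {m : ℕ} (Λ : Labelling R m) {d : G.Dart} (hd : R.facePerm^[4] d = d) :
    ∃ c : Λ.Chart 3, c.Holds squarePatch := by
  set e := d.symm with he
  let coord : ℕ → Fin m := fun i =>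
    if i = 0 then Λ.label e else if i = 1 then Λ.label (R.next e) else Λ.label (R.next (R.next e))
  have h₀ : Λ.label (R.next e) ≠ Λ.label e := Λ.label_next_ne e
  have h₁ : Λ.label (R.next (R.next e)) ≠ Λ.label (R.next e) := Λ.label_next_ne _
  have h₂ : Λ.label (R.next (R.next e)) ≠ Λ.label e := fun h =>
    Λ.next_next_ne e (Λ.dart_eq ((R.next_fst _).trans (R.next_fst _)) h)
  let c : Λ.Chart 3 := ⟨e.fst, coord, by
    intro a ha b hb h
    simp only [Set.mem_Iio] at ha hb
    interval_cases a <;> interval_cases b <;>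
      simp [coord, h₀, h₁, h₂, h₀.symm, h₁.symm, h₂.symm] at h ⊢⟩
  have hstar : c.StarAt 0 0 1 2 :=
    ⟨by decide, by decide, by decide, e, c.encodes_base, rfl, rfl, rfl⟩
  have hS : c.Holds ⟨3, [], [⟨0, 0, 1, 2⟩], [⟨0, 1, 2⟩, ⟨0, 2, 0⟩]⟩ := by
    refine ⟨rfl, by simp, by simpa using hstar, ?_⟩
    simpa using ⟨hstar.rotate.cornerAt, hstar.rotate.rotate.cornerAt⟩
  have hlab : Λ.label d = c.coord 0 := (Λ.label_symm d).symm
  obtain ⟨T, hT, hT'⟩ := hS.insertWalk (x := 0) (p := 0) (d := d) (l := [1, 0, 1, 0]) (by decide)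
    c.encodes_base hlab (Labelling.Chart.follows_square (by decide) (by decide) hlab rfl hd)
  obtain rfl : squarePatch = T := Option.some.inj hT
  exact ⟨c, hT'⟩

/-- The position of a vertex of the cube in the lists of codes. -/
def cubeIndex (v : Fin 3 → Bool) : ℕ := (v 0).toNat + 2 * (v 1).toNat + 4 * (v 2).toNat

/-- The position of a vertex of the prism in the lists of codes. -/
def prismIndex (v : Fin 6 × Fin 2) : ℕ := 2 * v.1 + v.2

/-- The position of a dart of the octahedron in the lists of codes. -/
def octahedronIndex (p q : Fin 3 × Bool) : ℕ :=
  8 * p.1 + 4 * p.2.toNat + 2 * (q.1 - p.1 - 1 : Fin 3) + q.2.toNat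

/-- The position of a vertex of the chamfered cube in the lists of codes. -/
def chamferIndex (v : ChamferVertex) : ℕ :=
  4 * cubeIndex v.1 + v.2.elim 0 fun i => (i : ℕ) + 1

def cubeCodes : List (List ℕ) := [[0, 1, 2, 3, 4, 5, 6, 7]]

def prismCodes : List (List ℕ) :=
  [[0, 2, 1, 3, 9, 11, 13, 15, 12, 14, 4, 6], [0, 1, 2, 3, 10, 11, 14, 15, 12, 13, 4, 5]]

def truncatedOctahedronCodes : List (List ℕ) :=
  [[0, 3, 1, 2, 60, 63, 61, 62, 36, 12, 4, 44, 51, 27, 19, 59, 33, 53, 37, 49, 10, 30, 14, 26]]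

def chamferedCubeCodes : List (List ℕ) :=
  [[4, 0, 12, 36, 108, 124, 76, 100, 33, 1, 49, 37, 117, 125, 113, 101, 10, 2, 14, 26, 94, 126, 78,
    90, 19, 3, 51, 27, 123, 127, 115, 91]]

def twistedChamferedCubeCodes : List (List ℕ) :=
  [[19, 3, 27, 51, 123, 4, 91, 115, 33, 1, 94, 49, 14, 12, 78, 113, 10, 2, 26, 117, 37, 36, 90, 101,
    127, 0, 126, 125, 108, 44, 110, 109],
  [10, 2, 14, 26, 94, 33, 78, 90, 19, 3, 108, 27, 36, 37, 100, 91, 4, 0, 12, 123, 51, 49, 76, 115,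
    126, 1, 124, 127, 117, 53, 116, 119],
  [4, 0, 12, 36, 108, 19, 76, 100, 33, 1, 94, 37, 26, 27, 90, 101, 10, 2, 14, 117, 49, 51, 78, 113,
    124, 3, 126, 125, 123, 59, 122, 121],
  [33, 1, 37, 49, 117, 10, 101, 113, 19, 3, 108, 51, 12, 14, 76, 115, 4, 0, 36, 123, 27, 26, 100,
    91, 125, 2, 124, 127, 94, 30, 92, 95]]

def codeTable : List (List ℕ) :=
  cubeCodes ++ prismCodes ++ truncatedOctahedronCodes ++ chamferedCubeCodes ++
    twistedChamferedCubeCodes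

theorem explore_squarePatch : squarePatch.explore codeTable 17 = true := by
  decide +kernel

instance : DecidableRel cubeGraph.Adj := fun x y => inferInstanceAs (Decidable (hammingDist x y = 1))

instance : DecidableRel hexagonalPrism.Adj := fun _ _ =>
  decidable_of_iff _ SimpleGraph.boxProd_adj.symm

instance : DecidableRel octahedron.Adj := fun x y => inferInstanceAs (Decidable (x.1 ≠ y.1))

instance : DecidableRel chamferedCube.Adj := fun x y =>
  decidable_of_iff _ (SimpleGraph.fromRel_adj _ x y).symm

instance (e : Sym2 ChamferVertex) : Decidable (e ∈ beltEdges) :=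
  inferInstanceAs (Decidable (∃ (i : Fin 3) (b : Bool),
    e = s((beltVertex i b, none), (beltVertex i b, some i))))

instance (e : Sym2 ChamferVertex) : Decidable (e ∈ twistedBeltEdges) :=
  inferInstanceAs (Decidable (∃ (i : Fin 3) (o : Option (Fin 3)), (o = none ∨ o = some i) ∧
    e = s((beltVertex i false, o), (beltVertex i true, o))))

instance : DecidableRel twistedChamferedCube.Adj := fun x y =>
  decidable_of_iff ((chamferedCube.Adj x y ∧ s(x, y) ∉ beltEdges) ∨
    (s(x, y) ∈ twistedBeltEdges ∧ x ≠ y)) (by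
      rw [twistedChamferedCube, SimpleGraph.sup_adj, SimpleGraph.deleteEdges_adj,
        SimpleGraph.fromEdgeSet_adj])

/-- The codes in the list `K`, read in the order given by `index`, describe the graph `T`. -/
structure IsCodeList {W : Type*} (T : SimpleGraph W) (index : W → ℕ) (K : List ℕ) : Prop where
  mem : ∀ t, K.getD (index t) 0 ∈ K
  exists_eq : ∀ x ∈ K, ∃ t, K.getD (index t) 0 = x
  inj : ∀ s t, K.getD (index s) 0 = K.getD (index t) 0 → s = t
  adj_iff : ∀ s t, T.Adj s t ↔ 2 ^ Nat.log2 (K.getD (index s) 0 ^^^ K.getD (index t) 0) =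
    K.getD (index s) 0 ^^^ K.getD (index t) 0

theorem Labelling.Chart.Exhausts.nonempty_iso_of_isCodeList {V : Type*} {G : SimpleGraph V}
    {R : RotationSystem G} {m k : ℕ} {Λ : Labelling R m} {c : Λ.Chart k} {K : List ℕ}
    (h : c.Exhausts K) {W : Type*} {T : SimpleGraph W} {index : W → ℕ}
    (hK : IsCodeList T index K) : Nonempty (G ≃g T) :=
  h.nonempty_iso T _ (fun x => ⟨hK.exists_eq x, fun ⟨t, ht⟩ => ht ▸ hK.mem t⟩) hK.inj hK.adj_iff

theorem isCodeList_cubeGraph : ∀ K ∈ cubeCodes, IsCodeList cubeGraph cubeIndex K := fun K hK =>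
  ⟨by revert K; decide +kernel, by revert K; decide +kernel, by revert K; decide +kernel,
    by revert K; decide +kernel⟩

theorem isCodeList_hexagonalPrism : ∀ K ∈ prismCodes, IsCodeList hexagonalPrism prismIndex K :=
  fun K hK => ⟨by revert K; decide +kernel, by revert K; decide +kernel,
    by revert K; decide +kernel, by revert K; decide +kernel⟩

theorem isCodeList_chamferedCube :
    ∀ K ∈ chamferedCubeCodes, IsCodeList chamferedCube chamferIndex K := fun K hK =>
  ⟨by revert K; decide +kernel, by revert K; decide +kernel, by revert K; decide +kernel,
    by revert K; decide +kernel⟩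

theorem isCodeList_twistedChamferedCube :
    ∀ K ∈ twistedChamferedCubeCodes, IsCodeList twistedChamferedCube chamferIndex K := fun K hK =>
  ⟨by revert K; decide +kernel, by revert K; decide +kernel, by revert K; decide +kernel,
    by revert K; decide +kernel⟩

theorem isCodeList_truncatedOctahedron : ∀ K ∈ truncatedOctahedronCodes,
    IsCodeList truncatedOctahedron (fun d => octahedronIndex d.fst d.snd) K := fun K hK => by
  refine ⟨?_, ?_, ?_, ?_⟩
  · have h : ∀ K ∈ truncatedOctahedronCodes, ∀ p q, octahedron.Adj p q →
      K.getD (octahedronIndex p q) 0 ∈ K := by decide +kernel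
    exact fun d => h K hK _ _ d.adj
  · have h : ∀ K ∈ truncatedOctahedronCodes, ∀ x ∈ K, ∃ p q, octahedron.Adj p q ∧
      K.getD (octahedronIndex p q) 0 = x := by decide +kernel
    intro x hx
    obtain ⟨p, q, hpq, h⟩ := h K hK x hx
    exact ⟨⟨(p, q), hpq⟩, h⟩
  · have h : ∀ K ∈ truncatedOctahedronCodes, ∀ p q, octahedron.Adj p q → ∀ p' q',
      octahedron.Adj p' q' → K.getD (octahedronIndex p q) 0 = K.getD (octahedronIndex p' q') 0 →
      (p, q) = (p', q') := by decide +kernel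
    exact fun d e hde => SimpleGraph.Dart.ext _ _ (h K hK _ _ d.adj _ _ e.adj hde)
  · have h : ∀ K ∈ truncatedOctahedronCodes, ∀ p q, octahedron.Adj p q → ∀ p' q',
      octahedron.Adj p' q' → (((p', q') = (q, p) ∨ (p = p' ∧ octahedron.Adj q q')) ↔
        2 ^ Nat.log2 (K.getD (octahedronIndex p q) 0 ^^^ K.getD (octahedronIndex p' q') 0) =
          K.getD (octahedronIndex p q) 0 ^^^ K.getD (octahedronIndex p' q') 0) := by
      decide +kernel
    intro d e
    rw [← h K hK _ _ d.adj _ _ e.adj]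
    exact or_congr (SimpleGraph.Dart.ext_iff _ _) Iff.rfl

theorem theorem1 {V : Type*} [Fintype V] (G : SimpleGraph V) [DecidableRel G.Adj]
    (R : RotationSystem G) (hG : IsGraphFourN G R) (hH : IsometricInHypercube G) :
    Nonempty (G ≃g cubeGraph) ∨
    Nonempty (G ≃g hexagonalPrism) ∨
    Nonempty (G ≃g truncatedOctahedron) ∨
    Nonempty (G ≃g chamferedCube) ∨
    Nonempty (G ≃g twistedChamferedCube) := by
  obtain ⟨m, φ, hφ⟩ := hH
  obtain ⟨Λ⟩ := hG.nonempty_labelling φ hφ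
  obtain ⟨d, hd⟩ := R.exists_square hG
  have hd' := Function.iterate_minimalPeriod (f := R.facePerm) (x := d)
  rw [show Function.minimalPeriod R.facePerm d = 4 from hd] at hd'
  obtain ⟨c, hc⟩ := Λ.exists_holds_squarePatch hd'
  obtain ⟨K, hK, k, c', hK'⟩ :=
    Labelling.Chart.exists_exhausts_of_explore _ hc explore_squarePatch
  simp only [codeTable, List.mem_append] at hK
  rcases hK with (((hK | hK) | hK) | hK) | hK
  · exact Or.inl (hK'.nonempty_iso_of_isCodeList (isCodeList_cubeGraph K hK))
  · exact Or.inr (Or.inl (hK'.nonempty_iso_of_isCodeList (isCodeList_hexagonalPrism K hK)))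
  · exact Or.inr (Or.inr (Or.inl
      (hK'.nonempty_iso_of_isCodeList (isCodeList_truncatedOctahedron K hK))))
  · exact Or.inr (Or.inr (Or.inr (Or.inl
      (hK'.nonempty_iso_of_isCodeList (isCodeList_chamferedCube K hK)))))
  · exact Or.inr (Or.inr (Or.inr (Or.inr
      (hK'.nonempty_iso_of_isCodeList (isCodeList_twistedChamferedCube K hK)))))
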